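/- Let $n\ge 1$ and let $H$ be a connected loopless graph (multiple edges allowed) on the vertex set $[n+1]=\{1,\dots,n+1\}$ with finite edge multiset $E$; each edge is written $(i,j)$ with $i<j$ and is regarded as directed from $i$ to $j$. Let $\mathrm{indeg}_H(v)$ be the number of edges of the form $(\cdot,v)$, and assume that every intermediate vertex $v\in\{2,\dots,n\}$ has at least one incoming edge $(\cdot,v)$ and at least one outgoing edge $(v,\cdot)$. For $\mathbf a\in\mathbb Z^{n+1}$ let $$\mathcal F_H(\mathbf a)=\Big\{f\in\mathbb R_{\ge 0}^{E}\ :\ \sum_{e=(i,j)\in E}f(e)\,(\mathbf e_i-\mathbf e_j)=\mathbf a\Big\}$$ be the flow polytope of $H$ with netflow $\mathbf a$, and let $$K_H(\mathbf a)=\#\Big\{b\in\mathbb Z_{\ge 0}^{E}\ :\ \sum_{e=(i,j)\in E}b(e)\,(\mathbf e_i-\mathbf e_j)=\mathbf a\Big\}$$ be the Kostant partition function of $H$. For a lattice polytope $P\subset\mathbb R^{E}$ of dimension $d$, its normalized volume $\mathrm{vol}(P)$ is $d!$ times its $d$-dimensional volume, scaled so that a fundamental domain of the lattice of integer points in the linear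 direction space of the affine hull of $P$ has volume $1$. Put $d_i=\mathrm{indeg}_H(i)-1$ for $i\in\{2,\dots,n\}$. Then $$\mathrm{vol}\big(\mathcal F_H(1,0,\dots,0,-1)\big)=K_H\Big(0,d_2,\dots,d_n,-\sum_{i=2}^{n}d_i\Big).$$ -/

import Mathlib

/-!
# Flow polytopes, Kostant partition functions and normalized volumes

The vertex set `[n+1] = {1, …, n+1}` is modelled by `Fin (n + 1)`: vertex `1` is `0` and vertex
`n + 1` is `Fin.last n`, so the intermediate vertices `2, …, n` are those `i` with
`0 < i` and `i < Fin.last n`.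
-/

noncomputable section

/-- A loopless (signless) multigraph on the vertex set `[n+1]` whose edges are labelled by `E`.
Every edge has a smaller (initial) and a bigger (final) endpoint, which are distinct because
there are no loops; multiple edges are allowed. -/
structure LooplessGraph (n : ℕ) (E : Type*) where
  /-- the smaller endpoint of an edge -/
  init : E → Fin (n + 1)
  /-- the bigger endpoint of an edge -/
  fin : E → Fin (n + 1)
  init_lt_fin : ∀ e, init e < fin e

namespace LooplessGraph

/-- The graph is connected: its underlying simple graph is connected. -/
def Connected {n : ℕ} {E : Type*} (H : LooplessGraph n E) : Prop :=
  (SimpleGraph.fromRel fun u v => ∃ e, H.init e = u ∧ H.fin e = v).Connected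

/-- The indegree of `i`: the number of edges whose bigger endpoint is `i`. -/
def indeg {n : ℕ} {E : Type*} [Fintype E] (H : LooplessGraph n E) (i : Fin (n + 1)) : ℕ :=
  (Finset.univ.filter fun e => H.fin e = i).card

/-- The outdegree of `i`: the number of edges whose smaller endpoint is `i`. -/
def outdeg {n : ℕ} {E : Type*} [Fintype E] (H : LooplessGraph n E) (i : Fin (n + 1)) : ℕ :=
  (Finset.univ.filter fun e => H.init e = i).card

/-- The positive root `e_i - e_j` of type `A_n` that belongs to an edge `(i, j)`, `i < j`. -/
def root {n : ℕ} {E : Type*} (H : LooplessGraph n E) (e : E) : Fin (n + 1) → ℤ :=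
  Pi.single (H.init e) 1 - Pi.single (H.fin e) 1

/-- The flow polytope `F_H(a) ⊆ ℝ^E`: all nonnegative real flows on the edges with netflow `a`. -/
def flowPolytope {n : ℕ} {E : Type*} [Fintype E] (H : LooplessGraph n E)
    (a : Fin (n + 1) → ℤ) : Set (E → ℝ) :=
  {f | (∀ e, 0 ≤ f e) ∧ ∀ v, ∑ e, f e * (H.root e v : ℝ) = (a v : ℝ)}

/-- The families of nonnegative integers `b` with `∑ e, b e • root e = a`. -/
def kostantSet {n : ℕ} {E : Type*} [Fintype E] (H : LooplessGraph n E)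
    (a : Fin (n + 1) → ℤ) : Set (E → ℕ) :=
  {b | ∑ e, b e • H.root e = a}

/-- The number of ways of writing `a` is finite, so that its `Set.ncard` is a true count. -/
theorem kostantSet_finite {n : ℕ} {E : Type*} [Fintype E] (H : LooplessGraph n E)
    (a : Fin (n + 1) → ℤ) : (H.kostantSet a).Finite := by
  classical
  set c : ℤ := ∑ v : Fin (n + 1), -(v.val : ℤ) * a v with hc
  refine (Set.finite_Iic (fun _ : E => c.toNat)).subset ?_
  intro b hb e
  have hb' : ∑ e, b e • H.root e = a := hb
  have hroot : ∀ e, ∑ v : Fin (n + 1), -(v.val : ℤ) * H.root e v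
      = (H.fin e).val - (H.init e).val := by
    intro e
    simp [root, mul_sub, Finset.sum_sub_distrib, Pi.single_apply]
    ring
  have h1 : c = ∑ e, (b e : ℤ) * ((H.fin e).val - (H.init e).val) := by
    rw [hc, ← hb']
    simp only [Finset.sum_apply, Pi.smul_apply, Finset.mul_sum]
    rw [Finset.sum_comm]
    refine Finset.sum_congr rfl fun e _ => ?_
    rw [← hroot e, Finset.mul_sum]
    refine Finset.sum_congr rfl fun v _ => ?_
    rw [nsmul_eq_mul]
    ring
  have hpos : ∀ e, (1 : ℤ) ≤ (H.fin e).val - (H.init e).val := by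
    intro e
    have := H.init_lt_fin e
    rw [Fin.lt_def] at this
    omega
  have h2 : (b e : ℤ) ≤ c := by
    rw [h1]
    calc (b e : ℤ) ≤ (b e : ℤ) * ((H.fin e).val - (H.init e).val) :=
          le_mul_of_one_le_right (by positivity) (hpos e)
      _ ≤ _ := Finset.single_le_sum
          (f := fun e => (b e : ℤ) * ((H.fin e).val - (H.init e).val))
          (fun i _ => mul_nonneg (by positivity) (by linarith [hpos i])) (Finset.mem_univ e)
  show b e ≤ c.toNat
  omega

/-- The Kostant partition function `K_H(a)`: the number of ways of writing `a` as a combination,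
with nonnegative integer coefficients, of the roots that belong to the edges of `H`. -/
def kostant {n : ℕ} {E : Type*} [Fintype E] (H : LooplessGraph n E)
    (a : Fin (n + 1) → ℤ) : ℕ :=
  (H.kostantSet a).ncard

/-- The integer `d_i = indeg_H(i) - 1`. -/
def shiftedIndeg {n : ℕ} {E : Type*} [Fintype E] (H : LooplessGraph n E)
    (i : Fin (n + 1)) : ℤ :=
  (H.indeg i : ℤ) - 1

/-- The vector `(0, d_2, …, d_n, -(d_2 + ⋯ + d_n))`. -/
def indegVector {n : ℕ} {E : Type*} [Fintype E] (H : LooplessGraph n E) : Fin (n + 1) → ℤ :=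
  fun v =>
    if v = 0 then 0
    else if v = Fin.last n then -∑ i ∈ Finset.Ioo 0 (Fin.last n), H.shiftedIndeg i
    else H.shiftedIndeg v

end LooplessGraph

/-- The netflow vector `(1, 0, …, 0, -1)`. -/
def unitNetflow (n : ℕ) : Fin (n + 1) → ℤ :=
  Pi.single 0 1 - Pi.single (Fin.last n) 1

/-- The integer points of a linear subspace `V` of `ℝ^E`. -/
def integerLattice {E : Type*} (V : Submodule ℝ (E → ℝ)) : Submodule ℤ V where
  carrier := {v | ∀ e, ∃ k : ℤ, (v : E → ℝ) e = k}
  zero_mem' := fun e => ⟨0, by simp⟩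
  add_mem' := by
    intro v w hv hw e
    obtain ⟨k, hk⟩ := hv e
    obtain ⟨l, hl⟩ := hw e
    exact ⟨k + l, by simp [hk, hl]⟩
  smul_mem' := by
    intro c v hv e
    obtain ⟨k, hk⟩ := hv e
    exact ⟨c * k, by simp [hk]⟩

/-- The normalized volume of a lattice polytope `P` in `ℝ^E`. Let `V` be the direction of the
affine span of `P` and let `d` be its dimension (the dimension of `P`). Translate `P` into `V` by
one of its points; the normalized volume is `d!` times the volume of the translate, measured
relative to the lattice of integer points of `V`, so that a unimodular `d`-simplex has normalized
volume `1`. The quotient of the volume by the covolume of the lattice does not depend on the choice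
of a Haar measure on `V`, nor on the point of `P`. The empty polytope has volume `0`. -/
def normalizedVolume {E : Type*} [Fintype E] (P : Set (E → ℝ)) : ℝ :=
  open Classical in
  if h : P.Nonempty then
    let V : Submodule ℝ (E → ℝ) := vectorSpan ℝ P
    let μ : MeasureTheory.Measure V := MeasureTheory.Measure.addHaar
    ((Module.finrank ℝ V).factorial : ℝ) *
      (μ.real {v : V | h.some + (v : E → ℝ) ∈ P} / ZLattice.covolume (integerLattice V) μ)
  else 0

end

/-!
The normalized volume of a lattice polytope is `d!` times the leading coefficient of the number of
integer points of its `t`-th dilate, so it suffices to estimate the number of integer flows of size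
`t` from the first to the last vertex up to lower-order terms.

Passing the vertices one after the other, exchange the condition on a flow `f` at a vertex (inflow
equals outflow) for the condition on a family `b` counted by `K_H(0, d_2, …, d_n, -∑ d_i)` (outflow
equals inflow plus `d_v`), where every edge `e` from the part already treated by `b` to the part
still carrying `f` has the weight `f e ^ b e / (b e)!`. By the multinomial theorem and Dirichlet's
integral this sum would be preserved if `f` were integrated rather than summed. On integers, the
weights `f.choose b` and `(b + f).choose b` turn the equality into inequalities in the two opposite
directions. At the first vertex the sums count flows; at the last vertex every `b` contributes
about `t ^ d / d!`.
-/

section Counting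

open Finset PowerSeries

variable {ι κ : Type*}

theorem sum_succ_eq_succ_sum_add_card_sub_one {s : Finset ι} (hs : s.Nonempty) (a : ι → ℕ) :
    ∑ i ∈ s, (a i + 1) = (∑ i ∈ s, a i + #s - 1) + 1 := by
  have := hs.card_pos
  rw [sum_add_distrib, sum_const, smul_eq_mul, mul_one]
  omega

variable [DecidableEq ι] [DecidableEq κ]

theorem sum_piAntidiag_prod_coeff {R : Type*} [CommSemiring R] (u : ι → PowerSeries R)
    (s : Finset ι) (k : ℕ) :
    ∑ c ∈ s.piAntidiag k, ∏ i ∈ s, coeff (c i) (u i) = coeff k (∏ i ∈ s, u i) := by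
  rw [coeff_prod]
  refine sum_bij' (fun c hc => Finsupp.onFinset s c (mem_piAntidiag.1 hc).2) (fun l _ => l)
    (fun c hc => ?_) (fun l hl => ?_) (fun _ _ => rfl) (fun _ _ => Finsupp.ext fun _ => rfl)
    (fun _ _ => rfl)
  · exact mem_finsuppAntidiag.2 ⟨(mem_piAntidiag.1 hc).1, Finsupp.support_onFinset_subset⟩
  · rw [mem_finsuppAntidiag] at hl
    exact mem_piAntidiag.2 ⟨hl.1, fun i hi => hl.2 (Finsupp.mem_support_iff.2 hi)⟩

theorem sum_piAntidiag_prod_choose (s : Finset ι) (m : ι → ℕ) (k : ℕ) :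
    ∑ c ∈ s.piAntidiag k, ∏ i ∈ s, (m i).choose (c i) = (∑ i ∈ s, m i).choose k := by
  have h := sum_piAntidiag_prod_coeff
    (fun i => ((1 + Polynomial.X : Polynomial ℕ) : PowerSeries ℕ) ^ m i) s k
  rw [prod_pow_eq_pow_sum] at h
  simpa only [← Polynomial.coe_pow, Polynomial.coeff_coe, Polynomial.coeff_one_add_X_pow,
    Nat.cast_id] using h

theorem sum_piAntidiag_prod_add_choose {s : Finset ι} (hs : s.Nonempty) (a : ι → ℕ) (k : ℕ) :
    ∑ c ∈ s.piAntidiag k, ∏ i ∈ s, (a i + c i).choose (a i)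
      = (∑ i ∈ s, a i + #s - 1 + k).choose (∑ i ∈ s, a i + #s - 1) := by
  have h := sum_piAntidiag_prod_coeff (fun i => PowerSeries.mk (1 : ℕ → ℤ) ^ (a i + 1)) s k
  rw [prod_pow_eq_pow_sum, sum_succ_eq_succ_sum_add_card_sub_one hs] at h
  simp only [mk_one_pow_eq_mk_choose_add, coeff_mk] at h
  exact_mod_cast h

theorem coeff_X_pow_mul_mk_one_pow (b d k : ℕ) :
    coeff k ((X : PowerSeries ℤ) ^ b * PowerSeries.mk (1 : ℕ → ℤ) ^ (b + d + 1))
      = (k + d).choose (b + d) := by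
  rw [coeff_X_pow_mul', mk_one_pow_eq_mk_choose_add, coeff_mk]
  split_ifs with h
  · congr 2
    omega
  · rw [Nat.choose_eq_zero_of_lt (by omega), Nat.cast_zero]

theorem sum_piAntidiag_prod_choose_const {s : Finset ι} (hs : s.Nonempty) (b : ι → ℕ) (k : ℕ) :
    ∑ g ∈ s.piAntidiag k, ∏ i ∈ s, (g i).choose (b i)
      = (k + (#s - 1)).choose (∑ i ∈ s, b i + (#s - 1)) := by
  have hcoeff (i : ι) (j : ℕ) :
      coeff j ((X : PowerSeries ℤ) ^ b i * PowerSeries.mk (1 : ℕ → ℤ) ^ (b i + 1))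
        = j.choose (b i) := coeff_X_pow_mul_mk_one_pow (b i) 0 j
  have h := sum_piAntidiag_prod_coeff
    (fun i => X ^ b i * PowerSeries.mk (1 : ℕ → ℤ) ^ (b i + 1)) s k
  rw [prod_mul_distrib, prod_pow_eq_pow_sum, prod_pow_eq_pow_sum,
    sum_succ_eq_succ_sum_add_card_sub_one hs, Nat.add_sub_assoc hs.card_pos,
    coeff_X_pow_mul_mk_one_pow] at h
  simp only [hcoeff] at h
  exact_mod_cast h

/- The next two inequalities replace an exact identity for divided powers: the integral of
`∏ g i ^ b i / b i!` over the dilated simplex `∑ g i = x` is `x ^ p / p!`, where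
`p = ∑ b i + #s - 1`, and the multinomial theorem expands this for `x = ∑ f j`. -/

theorem sum_piAntidiag_prod_add_choose_le {s : Finset ι} {o : Finset κ} (hs : s.Nonempty)
    (ho : o.Nonempty) (b : ι → ℕ) (f : κ → ℕ) :
    ∑ g ∈ s.piAntidiag (∑ j ∈ o, f j), ∏ i ∈ s, (b i + g i).choose (b i)
      ≤ ∑ c ∈ o.piAntidiag (∑ i ∈ s, b i + #s - 1), ∏ j ∈ o, (c j + f j).choose (c j) := by
  have hsymm (c : κ → ℕ) : ∏ j ∈ o, (c j + f j).choose (c j) = ∏ j ∈ o, (f j + c j).choose (f j) :=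
    prod_congr rfl fun j _ => by rw [Nat.choose_symm_add, add_comm]
  simp only [hsymm, sum_piAntidiag_prod_add_choose hs, sum_piAntidiag_prod_add_choose ho]
  rw [Nat.choose_symm_add (a := ∑ j ∈ o, f j + #o - 1), add_comm _ (∑ i ∈ s, b i + #s - 1)]
  have := ho.card_pos
  exact Nat.choose_le_choose _ (by omega)

theorem sum_piAntidiag_prod_choose_le {s : Finset ι} (hs : s.Nonempty) (o : Finset κ)
    (b : ι → ℕ) (f : κ → ℕ) :
    ∑ c ∈ o.piAntidiag (∑ i ∈ s, b i + #s - 1), ∏ j ∈ o, (f j).choose (c j)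
      ≤ ∑ g ∈ s.piAntidiag (∑ j ∈ o, f j), ∏ i ∈ s, (g i).choose (b i) := by
  rw [sum_piAntidiag_prod_choose, sum_piAntidiag_prod_choose_const hs,
    Nat.add_sub_assoc hs.card_pos]
  exact Nat.choose_le_choose _ (Nat.le_add_right _ _)

end Counting

section LayeredSolutions

open Finset

variable {E : Type*} [Fintype E]

/-- The layer function `s` and the demands `p` form a triangular system: the demand at layer `j`
depends only on the values at earlier layers. -/
def IsTriangular (s : E → ℕ) (p : ℕ → (E → ℕ) → ℕ) : Prop :=
  ∀ ⦃j b c⦄, (∀ e, s e < j → b e = c e) → p j b = p j c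

variable [DecidableEq E]

/-- The families `b : E → ℕ` that vanish at the layers from `k` on and have sum `p j b` over each
layer `j < k`, built layer by layer; see `mem_layeredSolutions`. -/
def layeredSolutions (s : E → ℕ) (p : ℕ → (E → ℕ) → ℕ) : ℕ → Finset (E → ℕ)
  | 0 => {0}
  | k + 1 => (layeredSolutions s p k).biUnion fun b =>
      (({e | s e = k} : Finset E).piAntidiag (p k b)).image (b + ·)

variable {s : E → ℕ} {p : ℕ → (E → ℕ) → ℕ} {k : ℕ} {b : E → ℕ}

theorem eq_zero_of_mem_layeredSolutions (hb : b ∈ layeredSolutions s p k) {e : E} (he : k ≤ s e) :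
    b e = 0 := by
  induction k generalizing b with
  | zero => rw [mem_singleton.1 hb, Pi.zero_apply]
  | succ k ih =>
    simp only [layeredSolutions, mem_biUnion, mem_image, mem_piAntidiag, mem_filter_univ] at hb
    obtain ⟨b', hb', c, ⟨-, hc⟩, rfl⟩ := hb
    rw [Pi.add_apply, ih hb' (by omega), zero_add]
    exact by_contra fun h => by have := hc e h; omega

theorem sum_layer_of_mem_layeredSolutions (hp : IsTriangular s p) (hb : b ∈ layeredSolutions s p k)
    {j : ℕ} (hj : j < k) : ∑ e with s e = j, b e = p j b := by
  induction k generalizing b with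
  | zero => omega
  | succ k ih =>
    simp only [layeredSolutions, mem_biUnion, mem_image, mem_piAntidiag, mem_filter_univ] at hb
    obtain ⟨b', hb', c, ⟨hsum, hc⟩, rfl⟩ := hb
    have hc0 (e : E) (he : s e ≠ k) : c e = 0 := by_contra fun h => he (hc e h)
    have hdemand : p j (b' + c) = p j b' :=
      hp fun e he => by rw [Pi.add_apply, hc0 e (by omega), add_zero]
    simp only [hdemand, Pi.add_apply, sum_add_distrib]
    rcases Nat.lt_succ_iff_lt_or_eq.1 hj with hj | rfl
    · rw [ih hb' hj, sum_eq_zero fun e he => hc0 e (by rw [mem_filter_univ] at he; omega), add_zero]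
    · rw [hsum, sum_eq_zero fun e he => eq_zero_of_mem_layeredSolutions hb'
        (mem_filter_univ e |>.1 he).ge, zero_add]

theorem mem_layeredSolutions_of_sum_layer (hp : IsTriangular s p) (hzero : ∀ e, k ≤ s e → b e = 0)
    (hsum : ∀ j < k, ∑ e with s e = j, b e = p j b) : b ∈ layeredSolutions s p k := by
  induction k generalizing b with
  | zero => exact mem_singleton.2 (funext fun e => hzero e (Nat.zero_le _))
  | succ k ih =>
    set b' : E → ℕ := fun e => if s e < k then b e else 0
    have hdemand {j : ℕ} (hj : j ≤ k) : p j b' = p j b := hp fun e he => if_pos (he.trans_le hj)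
    simp only [layeredSolutions, mem_biUnion, mem_image, mem_piAntidiag, mem_filter_univ]
    refine ⟨b', ih (fun e he => if_neg he.not_gt) fun j hj => ?_,
      fun e => if s e = k then b e else 0, ⟨?_, fun e he => (ite_ne_right_iff.1 he).1⟩,
      funext fun e => ?_⟩
    · rw [hdemand hj.le, ← hsum j (by omega)]
      exact sum_congr rfl fun e he => if_pos ((mem_filter_univ e |>.1 he).trans_lt hj)
    · rw [hdemand le_rfl, ← hsum k k.lt_succ_self]
      exact sum_congr rfl fun e he => if_pos (mem_filter_univ e |>.1 he)
    · rw [Pi.add_apply]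
      grind

theorem mem_layeredSolutions (hp : IsTriangular s p) : b ∈ layeredSolutions s p k ↔
    (∀ e, k ≤ s e → b e = 0) ∧ ∀ j < k, ∑ e with s e = j, b e = p j b :=
  ⟨fun hb => ⟨fun _ => eq_zero_of_mem_layeredSolutions hb,
    fun _ => sum_layer_of_mem_layeredSolutions hp hb⟩,
    fun h => mem_layeredSolutions_of_sum_layer hp h.1 h.2⟩

theorem sum_layeredSolutions_succ (s : E → ℕ) (p : ℕ → (E → ℕ) → ℕ) (k : ℕ)
    {M : Type*} [AddCommMonoid M] (F : (E → ℕ) → M) :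
    ∑ b ∈ layeredSolutions s p (k + 1), F b = ∑ b ∈ layeredSolutions s p k,
      ∑ c ∈ ({e | s e = k} : Finset E).piAntidiag (p k b), F (b + c) := by
  rw [layeredSolutions, sum_biUnion]
  · exact sum_congr rfl fun b _ => sum_image fun c _ c' _ h => add_left_cancel h
  · refine fun b hb b' hb' hne => disjoint_left.2 fun x hx hx' => hne (funext fun e => ?_)
    simp only [mem_image, mem_piAntidiag, mem_filter_univ] at hx hx'
    obtain ⟨c, ⟨-, hc⟩, rfl⟩ := hx
    obtain ⟨c', ⟨-, hc'⟩, h⟩ := hx'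
    have hbe := eq_zero_of_mem_layeredSolutions hb (e := e)
    have hbe' := eq_zero_of_mem_layeredSolutions hb' (e := e)
    have hsum : b' e + c' e = b e + c e := congrFun h e
    grind

end LayeredSolutions

section Netflow

open Finset

theorem eq_of_sum_eq_of_forall_ne {ι M : Type*} [Fintype ι] [AddCommGroup M] {x y : ι → M} (i : ι)
    (hsum : ∑ v, x v = ∑ v, y v) (h : ∀ v, v ≠ i → x v = y v) : x = y := by
  classical
  have hi : x i = y i := by
    rwa [← add_sum_erase _ _ (mem_univ i), ← add_sum_erase _ y (mem_univ i),
      sum_congr rfl fun v hv => h v (ne_of_mem_erase hv), add_left_inj] at hsum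
  exact funext fun v => (eq_or_ne v i).elim (fun hv => hv ▸ hi) (h v)

namespace LooplessGraph

variable {n : ℕ} {E : Type*} (H : LooplessGraph n E)

theorem init_lt_fin_val (e : E) : (H.init e : ℕ) < H.fin e := H.init_lt_fin e

theorem fin_val_le (e : E) : (H.fin e : ℕ) ≤ n := (H.fin e).is_le

theorem exists_incident_edge (hconn : H.Connected) (hn : 1 ≤ n) (v : Fin (n + 1)) :
    ∃ e, H.init e = v ∨ H.fin e = v := by
  have : Nontrivial (Fin (n + 1)) := Fin.nontrivial_iff_two_le.2 (by omega)
  obtain ⟨w, hw⟩ := hconn.preconnected.exists_adj_of_nontrivial v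
  obtain ⟨-, ⟨e, he, -⟩ | ⟨e, -, he⟩⟩ := (SimpleGraph.fromRel_adj _ _ _).1 hw
  exacts [⟨e, .inl he⟩, ⟨e, .inr he⟩]

variable [Fintype E]

/-- The netflow of an edge weighting `f` with values in `R`: at each vertex, outflow minus inflow.
`flowPolytope` and `kostantSet` are the nonnegative real and natural fibres of this map. -/
def netflow (R : Type*) [CommRing R] : (E → R) →ₗ[R] Fin (n + 1) → R :=
  Fintype.linearCombination R fun e v => (H.root e v : R)

/-- The edges whose bigger endpoint has index `j`. -/
def inEdges (j : ℕ) : Finset E := {e | (H.fin e : ℕ) = j}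

/-- The edges whose smaller endpoint has index `j`. -/
def outEdges (j : ℕ) : Finset E := {e | (H.init e : ℕ) = j}

@[simp] theorem mem_inEdges {j : ℕ} {e : E} : e ∈ H.inEdges j ↔ (H.fin e : ℕ) = j :=
  mem_filter_univ e

@[simp] theorem mem_outEdges {j : ℕ} {e : E} : e ∈ H.outEdges j ↔ (H.init e : ℕ) = j :=
  mem_filter_univ e

theorem inEdges_zero : H.inEdges 0 = ∅ :=
  eq_empty_of_forall_notMem fun e he =>
    (Nat.zero_le _).not_gt (H.mem_inEdges.1 he ▸ H.init_lt_fin_val e)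

theorem outEdges_last : H.outEdges n = ∅ :=
  eq_empty_of_forall_notMem fun e he =>
    ((H.mem_outEdges.1 he).symm.trans_lt (H.init_lt_fin_val e)).not_ge (H.fin_val_le e)

theorem indeg_eq_card_inEdges (v : Fin (n + 1)) : H.indeg v = #(H.inEdges v) := by
  simp only [indeg, inEdges, Fin.val_inj]

theorem outdeg_eq_card_outEdges (v : Fin (n + 1)) : H.outdeg v = #(H.outEdges v) := by
  simp only [outdeg, outEdges, Fin.val_inj]

section CommRing

variable {R : Type*} [CommRing R]

theorem netflow_apply (f : E → R) (v : Fin (n + 1)) :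
    H.netflow R f v = ∑ e, f e * (H.root e v : R) := by
  simp [netflow, Fintype.linearCombination_apply]

theorem sum_netflow_smul {M : Type*} [AddCommGroup M] [Module R M] (f : E → R)
    (x : Fin (n + 1) → M) :
    ∑ v, H.netflow R f v • x v = ∑ e, f e • (x (H.init e) - x (H.fin e)) := by
  simp only [netflow_apply, sum_smul, mul_smul]
  rw [sum_comm]
  refine sum_congr rfl fun e _ => ?_
  simp [root, ← smul_sum, sub_smul, Pi.single_apply, ite_smul]

theorem sum_netflow (f : E → R) : ∑ v, H.netflow R f v = 0 := by
  simpa using H.sum_netflow_smul f fun _ => (1 : R)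

theorem netflow_apply_eq_sub (f : E → R) (v : Fin (n + 1)) :
    H.netflow R f v = ∑ e ∈ H.outEdges v, f e - ∑ e ∈ H.inEdges v, f e := by
  rw [netflow_apply]
  simp only [outEdges, inEdges, sum_filter, ← sum_sub_distrib, Fin.val_inj]
  refine sum_congr rfl fun e _ => ?_
  simp only [root, Pi.sub_apply, Pi.single_apply, eq_comm (a := v)]
  split_ifs <;> simp

theorem mem_kostantSet_iff_netflow (R : Type*) [CommRing R] [CharZero R] {a : Fin (n + 1) → ℤ}
    {b : E → ℕ} :
    b ∈ H.kostantSet a ↔ H.netflow R (fun e => (b e : R)) = fun v => (a v : R) := by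
  simp only [kostantSet, Set.mem_ofPred_eq, funext_iff, netflow_apply, Finset.sum_apply,
    nsmul_eq_mul]
  exact forall_congr' fun v => by exact_mod_cast (Int.cast_inj (α := R)).symm

end CommRing

theorem mem_flowPolytope {a : Fin (n + 1) → ℤ} {f : E → ℝ} :
    f ∈ H.flowPolytope a ↔ 0 ≤ f ∧ H.netflow ℝ f = fun v => (a v : ℝ) := by
  simp only [flowPolytope, Set.mem_ofPred_eq, funext_iff, netflow_apply, Pi.le_def, Pi.zero_apply]

theorem mem_kostantSet_iff_forall_ne {a : Fin (n + 1) → ℤ} (ha : ∑ v, a v = 0)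
    (i : Fin (n + 1)) {b : E → ℕ} :
    b ∈ H.kostantSet a ↔ ∀ v, v ≠ i →
      ((∑ e ∈ H.outEdges v, b e : ℕ) : ℤ) = (∑ e ∈ H.inEdges v, b e : ℕ) + a v := by
  have hlocal (v : Fin (n + 1)) : H.netflow ℤ (fun e => (b e : ℤ)) v = a v ↔
      ((∑ e ∈ H.outEdges v, b e : ℕ) : ℤ) = (∑ e ∈ H.inEdges v, b e : ℕ) + a v := by
    rw [netflow_apply_eq_sub, Nat.cast_sum, Nat.cast_sum, sub_eq_iff_eq_add']
  simp only [H.mem_kostantSet_iff_netflow ℤ, ← hlocal]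
  exact ⟨fun h v _ => congrFun h v,
    eq_of_sum_eq_of_forall_ne i ((H.sum_netflow _).trans ha.symm)⟩

theorem add_mem_kostantSet {a a' : Fin (n + 1) → ℤ} {b b' : E → ℕ} (hb : b ∈ H.kostantSet a)
    (hb' : b' ∈ H.kostantSet a') : b + b' ∈ H.kostantSet (a + a') := by
  rw [kostantSet, Set.mem_ofPred_eq] at hb hb' ⊢
  simp only [Pi.add_apply, add_smul, sum_add_distrib, hb, hb']

theorem single_mem_kostantSet [DecidableEq E] (e : E) :
    Pi.single e 1 ∈ H.kostantSet (H.root e) := by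
  simp [kostantSet, Pi.single_apply]

theorem zero_mem_kostantSet : 0 ∈ H.kostantSet 0 := by
  simp [kostantSet]

theorem inEdges_nonempty (hconn : H.Connected)
    (hin : ∀ i : Fin (n + 1), 0 < i → i < Fin.last n → 1 ≤ H.indeg i) (j : ℕ) (h1 : 1 ≤ j)
    (hj : j ≤ n) : (H.inEdges j).Nonempty := by
  rcases hj.lt_or_eq with hj | rfl
  · rw [← card_pos, ← H.indeg_eq_card_inEdges ⟨j, by omega⟩]
    exact hin _ (Fin.lt_def.2 h1) (Fin.lt_def.2 hj)
  · obtain ⟨e, he | he⟩ := H.exists_incident_edge hconn h1 (Fin.last j)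
    · exact absurd (he ▸ H.init_lt_fin e) (Fin.le_last _).not_gt
    · exact ⟨e, by simp [he]⟩

theorem outEdges_nonempty (hconn : H.Connected)
    (hout : ∀ i : Fin (n + 1), 0 < i → i < Fin.last n → 1 ≤ H.outdeg i) (j : ℕ) (hj : j < n) :
    (H.outEdges j).Nonempty := by
  rcases Nat.eq_zero_or_pos j with rfl | h1
  · obtain ⟨e, he | he⟩ := H.exists_incident_edge hconn hj 0
    · exact ⟨e, by simp [he]⟩
    · exact absurd (he ▸ H.init_lt_fin e) (Fin.zero_le _).not_gt
  · rw [← card_pos, ← H.outdeg_eq_card_outEdges ⟨j, by omega⟩]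
    exact hout _ (Fin.lt_def.2 h1) (Fin.lt_def.2 hj)

theorem exists_flow_to_last (hout : ∀ j < n, (H.outEdges j).Nonempty) (v : Fin (n + 1)) :
    (H.kostantSet (Pi.single v 1 - Pi.single (Fin.last n) 1)).Nonempty := by
  classical
  induction v using WellFoundedGT.induction with
  | ind v ih =>
    rcases eq_or_ne v (Fin.last n) with rfl | hv
    · exact ⟨0, by simpa using H.zero_mem_kostantSet⟩
    obtain ⟨e, he⟩ := hout v (Fin.val_lt_last hv)
    obtain rfl : H.init e = v := Fin.ext (H.mem_outEdges.1 he)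
    obtain ⟨b, hb⟩ := ih (H.fin e) (H.init_lt_fin e)
    exact ⟨_, by simpa [root] using H.add_mem_kostantSet (H.single_mem_kostantSet e) hb⟩

theorem exists_flow_from_zero (hin : ∀ j, 1 ≤ j → j ≤ n → (H.inEdges j).Nonempty)
    (v : Fin (n + 1)) : (H.kostantSet (Pi.single 0 1 - Pi.single v 1)).Nonempty := by
  classical
  induction v using WellFoundedLT.induction with
  | ind v ih =>
    rcases eq_or_ne v 0 with rfl | hv
    · exact ⟨0, by simpa using H.zero_mem_kostantSet⟩
    obtain ⟨e, he⟩ := hin v (Fin.pos_iff_ne_zero.2 hv) v.is_le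
    obtain rfl : H.fin e = v := Fin.ext (H.mem_inEdges.1 he)
    obtain ⟨b, hb⟩ := ih (H.init e) (H.init_lt_fin e)
    exact ⟨_, by simpa [root] using H.add_mem_kostantSet hb (H.single_mem_kostantSet e)⟩

end LooplessGraph

theorem sum_unitNetflow (n : ℕ) : ∑ v, unitNetflow n v = 0 := by
  simp [unitNetflow]

namespace LooplessGraph

variable {n : ℕ} {E : Type*} [Fintype E] (H : LooplessGraph n E)

theorem sum_indegVector (hn : 1 ≤ n) : ∑ v, H.indegVector v = 0 := by
  have hlast : (0 : Fin (n + 1)) < Fin.last n := Fin.lt_def.2 hn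
  have hIoo : ∑ v ∈ Ioo 0 (Fin.last n), H.indegVector v
      = ∑ v ∈ Ioo 0 (Fin.last n), H.shiftedIndeg v := sum_congr rfl fun v hv => by
    rw [indegVector, if_neg (mem_Ioo.1 hv).1.ne', if_neg (mem_Ioo.1 hv).2.ne]
  have huniv : (univ : Finset (Fin (n + 1))) = Icc 0 (Fin.last n) :=
    (eq_univ_of_forall fun v => mem_Icc.2 ⟨Fin.zero_le v, Fin.le_last v⟩).symm
  rw [huniv, ← Ioc_insert_left hlast.le, sum_insert left_notMem_Ioc, ← Ioo_insert_right hlast,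
    sum_insert right_notMem_Ioo, hIoo]
  simp [indegVector, hlast.ne']

end LooplessGraph

end Netflow

section MixedSums

open Finset

theorem prod_union_apply_add {ι M N : Type*} [DecidableEq ι] [CommMonoid M] [AddZeroClass N]
    {s o : Finset ι} (h : Disjoint s o) (ψ : ι → N → M) {f g : ι → N} (hf : ∀ e ∈ s, f e = 0)
    (hg : ∀ e ∈ o, g e = 0) :
    ∏ e ∈ s ∪ o, ψ e ((f + g) e) = (∏ e ∈ s, ψ e (g e)) * ∏ e ∈ o, ψ e (f e) := by
  rw [prod_union h]
  exact congrArg₂ _ (prod_congr rfl fun e he => by rw [Pi.add_apply, hf e he, zero_add])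
    (prod_congr rfl fun e he => by rw [Pi.add_apply, hg e he, add_zero])

namespace LooplessGraph

variable {n : ℕ} {E : Type*} [Fintype E] (H : LooplessGraph n E)

/-- The sum of a flow of size `t` over the edges into the vertex with index `n - j`, in terms of
its values on the edges into vertices with bigger indices. -/
def flowDemand (t j : ℕ) (f : E → ℕ) : ℕ := if j = 0 then t else ∑ e ∈ H.outEdges (n - j), f e

/-- The sum over the edges out of the vertex with index `j` of a family counted by
`H.kostant H.indegVector`, in terms of its values on the edges into that vertex. The truncated
subtraction gives the correct value `0` at the vertex with index `0`, which has no incoming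
edges. -/
def indegDemand (j : ℕ) (b : E → ℕ) : ℕ := ∑ e ∈ H.inEdges j, b e + #(H.inEdges j) - 1

theorem flowDemand_of_lt {k : ℕ} (hk : k < n) (t : ℕ) (f : E → ℕ) :
    H.flowDemand t (n - k) f = ∑ e ∈ H.outEdges k, f e := by
  rw [flowDemand, if_neg (by omega), Nat.sub_sub_self hk.le]

theorem indegDemand_zero (b : E → ℕ) : H.indegDemand 0 b = 0 := by
  simp [indegDemand, inEdges_zero]

theorem isTriangular_flowDemand (t : ℕ) :
    IsTriangular (fun e => n - (H.fin e : ℕ)) (H.flowDemand t) := by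
  intro j f g h
  unfold flowDemand
  split_ifs with hj
  · rfl
  · refine sum_congr rfl fun e he => h e ?_
    have := H.init_lt_fin_val e
    have := H.fin_val_le e
    rw [mem_outEdges] at he
    change n - (H.fin e : ℕ) < j
    omega

theorem isTriangular_indegDemand : IsTriangular (fun e => (H.init e : ℕ)) H.indegDemand := by
  intro j b c h
  unfold indegDemand
  rw [sum_congr rfl fun e he => h e ((H.init_lt_fin_val e).trans_eq (H.mem_inEdges.1 he))]

theorem inEdges_eq_filter {j : ℕ} (hj : j ≤ n) :
    H.inEdges j = ({e | n - (H.fin e : ℕ) = n - j} : Finset E) := by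
  ext e
  have := H.fin_val_le e
  rw [mem_inEdges, mem_filter_univ]
  omega

/-- The edges from a vertex with index smaller than `k` to one with index at least `k`. -/
def crossing (k : ℕ) : Finset E := {e | (H.init e : ℕ) < k ∧ k ≤ H.fin e}

/-- The edges that pass strictly over the vertex with index `k`. -/
def passing (k : ℕ) : Finset E := {e | (H.init e : ℕ) < k ∧ k < H.fin e}

theorem disjoint_inEdges_passing (k : ℕ) : Disjoint (H.inEdges k) (H.passing k) :=
  disjoint_left.2 fun e he he' => ((mem_filter_univ e).1 he').2.ne' (H.mem_inEdges.1 he)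

theorem disjoint_outEdges_passing (k : ℕ) : Disjoint (H.outEdges k) (H.passing k) :=
  disjoint_left.2 fun e he he' => ((mem_filter_univ e).1 he').1.ne (H.mem_outEdges.1 he)

theorem cast_indegDemand (hin : ∀ j, 1 ≤ j → j ≤ n → (H.inEdges j).Nonempty) {v : Fin (n + 1)}
    (hv : v ≠ Fin.last n) (b : E → ℕ) :
    (H.indegDemand v b : ℤ) = (∑ e ∈ H.inEdges v, b e : ℕ) + H.indegVector v := by
  rcases eq_or_ne v 0 with rfl | h0
  · simp [indegDemand_zero, inEdges_zero, indegVector]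
  · have := (hin v (Fin.pos_iff_ne_zero.2 h0) v.is_le).card_pos
    rw [indegVector, if_neg h0, if_neg hv, shiftedIndeg, indeg_eq_card_inEdges, indegDemand]
    omega

theorem mem_kostantSet_indegVector_iff (hin : ∀ j, 1 ≤ j → j ≤ n → (H.inEdges j).Nonempty)
    (hn : 1 ≤ n) {b : E → ℕ} : b ∈ H.kostantSet H.indegVector ↔
      ∀ j < n, ∑ e ∈ H.outEdges j, b e = H.indegDemand j b := by
  rw [H.mem_kostantSet_iff_forall_ne (H.sum_indegVector hn) (Fin.last n)]
  refine ⟨fun h j hj => ?_, fun h v hv => ?_⟩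
  · have hv : (⟨j, by omega⟩ : Fin (n + 1)) ≠ Fin.last n := Fin.ne_of_val_ne hj.ne
    exact Nat.cast_injective ((h _ hv).trans (H.cast_indegDemand hin hv b).symm)
  · rw [← H.cast_indegDemand hin hv, h v (Fin.val_lt_last hv)]

theorem cast_flowDemand (t : ℕ) {v : Fin (n + 1)} (hv : v ≠ 0) (f : E → ℕ) :
    (H.flowDemand t (n - v) f : ℤ) = (∑ e ∈ H.outEdges v, f e : ℕ) - (t • unitNetflow n) v := by
  rcases eq_or_ne v (Fin.last n) with rfl | hlast
  · simp [flowDemand, outEdges_last, unitNetflow, hv]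
  · simp [H.flowDemand_of_lt (Fin.val_lt_last hlast), unitNetflow, hv, hlast]

theorem mem_kostantSet_smul_unitNetflow_iff (t : ℕ) {f : E → ℕ} :
    f ∈ H.kostantSet (t • unitNetflow n) ↔
      ∀ j < n, ∑ e ∈ H.inEdges (n - j), f e = H.flowDemand t j f := by
  have hsum : ∑ v, (t • unitNetflow n) v = 0 := by
    simp only [Pi.smul_apply, ← smul_sum, sum_unitNetflow, smul_zero]
  rw [H.mem_kostantSet_iff_forall_ne hsum 0]
  refine ⟨fun h j hj => ?_, fun h v hv => ?_⟩
  · have hv : (⟨n - j, by omega⟩ : Fin (n + 1)) ≠ 0 := Fin.ne_of_val_ne (Nat.sub_pos_of_lt hj).ne'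
    have hdemand := H.cast_flowDemand t hv f
    rw [Nat.sub_sub_self hj.le] at hdemand
    exact Nat.cast_injective ((eq_sub_of_add_eq (h _ hv).symm).trans hdemand.symm)
  · have hpos : 0 < (v : ℕ) := Fin.pos_iff_ne_zero.2 hv
    have hdemand := h (n - v) (by omega)
    rw [Nat.sub_sub_self v.is_le] at hdemand
    rw [hdemand, H.cast_flowDemand t hv, sub_add_cancel]

variable [DecidableEq E]

theorem crossing_eq_inEdges_union (k : ℕ) : H.crossing k = H.inEdges k ∪ H.passing k := by
  ext e
  have := H.init_lt_fin_val e
  simp only [crossing, passing, mem_union, mem_inEdges, mem_filter_univ]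
  omega

theorem crossing_succ_eq_outEdges_union (k : ℕ) :
    H.crossing (k + 1) = H.outEdges k ∪ H.passing k := by
  ext e
  have := H.init_lt_fin_val e
  simp only [crossing, passing, mem_union, mem_outEdges, mem_filter_univ]
  omega

/-- The flows of size `t` on the edges into vertices with index at least `k`, restricted only by
conservation at these vertices. -/
def flowsFrom (t k : ℕ) : Finset (E → ℕ) :=
  layeredSolutions (fun e => n - (H.fin e : ℕ)) (H.flowDemand t) (n + 1 - k)

/-- The families on the edges out of vertices with index smaller than `k` that satisfy the
conditions of `H.kostantSet H.indegVector` at these vertices. -/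
def kostantBelow (k : ℕ) : Finset (E → ℕ) :=
  layeredSolutions (fun e => (H.init e : ℕ)) H.indegDemand k

/-- The sum over the flows from `k` on and the Kostant families below `k` of the product of the
weights `φ (b e) (f e)` of the edges crossing from below `k`. -/
def mixedSum (φ : ℕ → ℕ → ℕ) (t k : ℕ) : ℕ :=
  ∑ f ∈ H.flowsFrom t k, ∑ b ∈ H.kostantBelow k, ∏ e ∈ H.crossing k, φ (b e) (f e)

theorem mixedSum_eq_sum_inEdges (φ : ℕ → ℕ → ℕ) (t : ℕ) {k : ℕ} (hk : k ≤ n) :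
    H.mixedSum φ t k = ∑ f ∈ H.flowsFrom t (k + 1), ∑ b ∈ H.kostantBelow k,
      (∑ g ∈ (H.inEdges k).piAntidiag (H.flowDemand t (n - k) f),
        ∏ e ∈ H.inEdges k, φ (b e) (g e)) * ∏ e ∈ H.passing k, φ (b e) (f e) := by
  rw [mixedSum, flowsFrom, Nat.succ_sub hk, sum_layeredSolutions_succ, flowsFrom,
    Nat.add_sub_add_right, ← H.inEdges_eq_filter hk]
  refine sum_congr rfl fun f hf => ?_
  rw [sum_comm]
  refine sum_congr rfl fun b _ => ?_
  rw [sum_mul]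
  refine sum_congr rfl fun g hg => ?_
  rw [crossing_eq_inEdges_union]
  refine prod_union_apply_add (H.disjoint_inEdges_passing k) (fun e => φ (b e))
    (fun e he => ?_) (fun e he => ?_)
  · rw [mem_inEdges] at he
    exact eq_zero_of_mem_layeredSolutions hf (by omega)
  · exact by_contra fun h => disjoint_left.1 (H.disjoint_inEdges_passing k)
      ((mem_piAntidiag.1 hg).2 e h) he

theorem mixedSum_succ_eq_sum_outEdges (φ : ℕ → ℕ → ℕ) (t k : ℕ) :
    H.mixedSum φ t (k + 1) = ∑ f ∈ H.flowsFrom t (k + 1), ∑ b ∈ H.kostantBelow k,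
      (∑ c ∈ (H.outEdges k).piAntidiag (H.indegDemand k b),
        ∏ e ∈ H.outEdges k, φ (c e) (f e)) * ∏ e ∈ H.passing k, φ (b e) (f e) := by
  rw [mixedSum]
  refine sum_congr rfl fun f _ => ?_
  rw [kostantBelow, sum_layeredSolutions_succ]
  refine sum_congr rfl fun b hb => ?_
  rw [sum_mul]
  refine sum_congr rfl fun c hc => ?_
  rw [crossing_succ_eq_outEdges_union]
  refine prod_union_apply_add (H.disjoint_outEdges_passing k) (fun e x => φ x (f e))
    (fun e he => eq_zero_of_mem_layeredSolutions hb (H.mem_outEdges.1 he).ge) (fun e he => ?_)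
  exact by_contra fun h => disjoint_left.1 (H.disjoint_outEdges_passing k)
    ((mem_piAntidiag.1 hc).2 e h) he

theorem mixedSum_add_choose_le_succ (t : ℕ) {k : ℕ} (hk : k < n) (hin : (H.inEdges k).Nonempty)
    (hout : (H.outEdges k).Nonempty) :
    H.mixedSum (fun b x => (b + x).choose b) t k
      ≤ H.mixedSum (fun b x => (b + x).choose b) t (k + 1) := by
  rw [H.mixedSum_eq_sum_inEdges _ _ hk.le, mixedSum_succ_eq_sum_outEdges]
  gcongr with f _ b _
  rw [H.flowDemand_of_lt hk, indegDemand]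
  exact sum_piAntidiag_prod_add_choose_le hin hout b f

theorem mixedSum_choose_succ_le (t : ℕ) {k : ℕ} (hk : k < n) (hin : (H.inEdges k).Nonempty) :
    H.mixedSum (fun b x => x.choose b) t (k + 1) ≤ H.mixedSum (fun b x => x.choose b) t k := by
  rw [H.mixedSum_eq_sum_inEdges _ _ hk.le, mixedSum_succ_eq_sum_outEdges]
  gcongr with f _ b _
  rw [H.flowDemand_of_lt hk, indegDemand]
  exact sum_piAntidiag_prod_choose_le hin _ b f

theorem kostantBelow_one : H.kostantBelow 1 = {0} := by
  simp [kostantBelow, layeredSolutions, indegDemand_zero]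

theorem mixedSum_one {φ : ℕ → ℕ → ℕ} (hφ : ∀ x, φ 0 x = 1) (t : ℕ) :
    H.mixedSum φ t 1 = #(H.flowsFrom t 1) := by
  simp [mixedSum, kostantBelow_one, hφ]

theorem mixedSum_last (φ : ℕ → ℕ → ℕ) (t : ℕ) :
    H.mixedSum φ t n = ∑ b ∈ H.kostantBelow n,
      ∑ g ∈ (H.inEdges n).piAntidiag t, ∏ e ∈ H.inEdges n, φ (b e) (g e) := by
  have hpassing : H.passing n = ∅ :=
    filter_eq_empty_iff.2 fun e _ h => h.2.not_ge (H.fin_val_le e)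
  rw [H.mixedSum_eq_sum_inEdges _ _ le_rfl, flowsFrom, Nat.sub_self, layeredSolutions,
    sum_singleton]
  simp [flowDemand, hpassing]

theorem sum_outEdges_of_mem_kostantBelow {k : ℕ} {b : E → ℕ} (hb : b ∈ H.kostantBelow k) {j : ℕ}
    (hj : j < k) : ∑ e ∈ H.outEdges j, b e = H.indegDemand j b :=
  sum_layer_of_mem_layeredSolutions H.isTriangular_indegDemand hb hj

theorem indegDemand_last (hin : ∀ j, 1 ≤ j → j ≤ n → (H.inEdges j).Nonempty) (hn : 1 ≤ n)
    {b : E → ℕ} (hb : b ∈ H.kostantBelow n) : H.indegDemand n b = Fintype.card E - n := by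
  have hlayer (j : ℕ) (hj : j ∈ range n) : ∑ e ∈ H.inEdges j, (b e + 1) + (if j = 0 then 1 else 0)
      = ∑ e ∈ H.outEdges j, b e + 1 := by
    rw [mem_range] at hj
    rw [H.sum_outEdges_of_mem_kostantBelow hb hj]
    rcases Nat.eq_zero_or_pos j with rfl | h1
    · simp [indegDemand_zero, inEdges_zero]
    · rw [sum_succ_eq_succ_sum_add_card_sub_one (hin j h1 hj.le), if_neg h1.ne', add_zero,
        indegDemand]
  have hsum := sum_congr rfl hlayer
  have hout : ∑ j ∈ range n, ∑ e ∈ H.outEdges j, b e = ∑ e, b e :=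
    sum_fiberwise_of_maps_to
      (fun e _ => mem_range.2 ((H.init_lt_fin_val e).trans_le (H.fin_val_le e))) _
  have hall : ∑ j ∈ range (n + 1), ∑ e ∈ H.inEdges j, (b e + 1) = ∑ e, (b e + 1) :=
    sum_fiberwise_of_maps_to (fun e _ => mem_range.2 (H.fin e).2) _
  simp only [sum_range_succ, sum_succ_eq_succ_sum_add_card_sub_one (hin n hn le_rfl)] at hall
  simp only [sum_add_distrib, sum_ite_eq', mem_range, sum_const, smul_eq_mul, mul_one, card_range,
    hout, card_univ, if_pos (Nat.lt_of_lt_of_le one_pos hn)] at hsum hall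
  rw [indegDemand]
  omega

theorem mixedSum_add_choose_last (hin : ∀ j, 1 ≤ j → j ≤ n → (H.inEdges j).Nonempty) (hn : 1 ≤ n)
    (t : ℕ) : H.mixedSum (fun b x => (b + x).choose b) t n
      = #(H.kostantBelow n) * (Fintype.card E - n + t).choose (Fintype.card E - n) := by
  rw [mixedSum_last, card_eq_sum_ones, sum_mul]
  refine sum_congr rfl fun b hb => ?_
  rw [sum_piAntidiag_prod_add_choose (hin n hn le_rfl), one_mul, ← H.indegDemand_last hin hn hb,
    indegDemand]

theorem le_mixedSum_choose_last (hin : ∀ j, 1 ≤ j → j ≤ n → (H.inEdges j).Nonempty) (hn : 1 ≤ n)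
    (t : ℕ) : #(H.kostantBelow n) * t.choose (Fintype.card E - n)
      ≤ H.mixedSum (fun b x => x.choose b) t n := by
  rw [mixedSum_last, card_eq_sum_ones, sum_mul]
  refine sum_le_sum fun b hb => ?_
  have hnonempty := hin n hn le_rfl
  rw [sum_piAntidiag_prod_choose_const hnonempty, one_mul, ← H.indegDemand_last hin hn hb,
    indegDemand, Nat.add_sub_assoc hnonempty.card_pos]
  exact Nat.choose_le_choose _ (Nat.le_add_right _ _)

theorem card_flowsFrom_le (hin : ∀ j, 1 ≤ j → j ≤ n → (H.inEdges j).Nonempty)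
    (hout : ∀ j < n, (H.outEdges j).Nonempty) (hn : 1 ≤ n) (t : ℕ) :
    #(H.flowsFrom t 1)
      ≤ #(H.kostantBelow n) * (Fintype.card E - n + t).choose (Fintype.card E - n) := by
  rw [← H.mixedSum_add_choose_last hin hn, ← H.mixedSum_one (φ := fun b x => (b + x).choose b)
    fun x => Nat.choose_zero_right _]
  refine monotoneOn_of_le_add_one (s := Set.Icc 1 n) Set.ordConnected_Icc (fun k _ hk hk' => ?_)
    (Set.left_mem_Icc.2 hn) (Set.right_mem_Icc.2 hn) hn
  exact H.mixedSum_add_choose_le_succ t hk'.2 (hin k hk.1 hk.2) (hout k hk'.2)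

theorem le_card_flowsFrom (hin : ∀ j, 1 ≤ j → j ≤ n → (H.inEdges j).Nonempty) (hn : 1 ≤ n)
    (t : ℕ) : #(H.kostantBelow n) * t.choose (Fintype.card E - n) ≤ #(H.flowsFrom t 1) := by
  refine (H.le_mixedSum_choose_last hin hn t).trans ?_
  rw [← H.mixedSum_one (φ := fun b x => x.choose b) fun x => Nat.choose_zero_right _]
  refine antitoneOn_of_add_one_le (s := Set.Icc 1 n) Set.ordConnected_Icc (fun k _ hk hk' => ?_)
    (Set.left_mem_Icc.2 hn) (Set.right_mem_Icc.2 hn) hn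
  exact H.mixedSum_choose_succ_le t hk'.2 (hin k hk.1 hk.2)

theorem coe_kostantBelow_last (hin : ∀ j, 1 ≤ j → j ≤ n → (H.inEdges j).Nonempty) (hn : 1 ≤ n) :
    (H.kostantBelow n : Set (E → ℕ)) = H.kostantSet H.indegVector := by
  ext b
  rw [H.mem_kostantSet_indegVector_iff hin hn, mem_coe, kostantBelow,
    mem_layeredSolutions H.isTriangular_indegDemand]
  exact and_iff_right fun e he =>
    absurd ((H.init_lt_fin_val e).trans_le (H.fin_val_le e)) he.not_gt

theorem coe_flowsFrom_one (t : ℕ) :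
    (H.flowsFrom t 1 : Set (E → ℕ)) = H.kostantSet (t • unitNetflow n) := by
  ext f
  rw [mem_kostantSet_smul_unitNetflow_iff, mem_coe, flowsFrom,
    mem_layeredSolutions (H.isTriangular_flowDemand t), Nat.add_sub_cancel]
  refine (and_iff_right fun e he => ?_).trans (forall₂_congr fun j hj => ?_)
  · have := H.init_lt_fin_val e
    have := H.fin_val_le e
    omega
  · rw [H.inEdges_eq_filter (Nat.sub_le n j), Nat.sub_sub_self hj.le]

end LooplessGraph

end MixedSums

section LatticePointCount

open MeasureTheory Module Filter Topology Bornology Pointwise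

section Covolume

variable {F : Type*} [NormedAddCommGroup F] [NormedSpace ℝ F] [MeasurableSpace F]
  [BorelSpace F] (μ : Measure F) [μ.IsAddHaarMeasure]

theorem exists_measureReal_eq_mul_volumeReal_image {ι : Type*} [Fintype ι] (B : Basis ι ℝ F) :
    ∃ c : ℝ, ∀ s : Set F, μ.real s = c * volume.real (B.equivFun '' s) := by
  set e := B.equivFunL
  have : (μ.map e).IsAddHaarMeasure := e.isAddHaarMeasure_map μ
  have hsmul := Measure.isAddLeftInvariant_eq_smul (μ.map e) volume
  set c := Measure.addHaarScalarFactor (μ.map e) volume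
  have hmap (s : Set F) : μ s = μ.map e (e '' s) := by
    have hpreimage : μ.map e (e '' s) = μ (e ⁻¹' (e '' s)) :=
      e.toHomeomorph.toMeasurableEquiv.map_apply (e '' s)
    rw [hpreimage, Set.preimage_image_eq s e.injective]
  refine ⟨c, fun s => ?_⟩
  rw [Measure.real, hmap, hsmul, Measure.smul_apply, ENNReal.smul_def, smul_eq_mul,
    ENNReal.toReal_mul, ENNReal.coe_toReal]
  rfl

variable [FiniteDimensional ℝ F]

theorem measureReal_eq_covolume_mul {ι : Type*} [Fintype ι] (L : Submodule ℤ F)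
    [DiscreteTopology L] [IsZLattice ℝ L] (b : Basis ι ℤ L) (s : Set F) :
    μ.real s = ZLattice.covolume L μ * volume.real ((b.ofZLatticeBasis ℝ L).equivFun '' s) := by
  set B := b.ofZLatticeBasis ℝ L
  obtain ⟨c, hc⟩ := exists_measureReal_eq_mul_volumeReal_image μ B
  have himage : B.equivFun '' ZSpan.fundamentalDomain B
      = ZSpan.fundamentalDomain (Pi.basisFun ℝ ι) := by
    rw [ZSpan.map_fundamentalDomain]
    congr 1
    classical
    ext i j
    rw [Basis.map_apply, Basis.equivFun_self, Pi.basisFun_apply, Pi.single_apply]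
    exact if_congr eq_comm rfl rfl
  have hcovolume : ZLattice.covolume L μ = c := by
    rw [ZLattice.covolume_eq_measure_fundamentalDomain L μ (ZLattice.isAddFundamentalDomain b μ),
      hc, himage, ZSpan.fundamentalDomain_pi_basisFun, Measure.real, volume_pi_pi]
    simp
  rw [hc, hcovolume]

theorem tendsto_card_inter_inv_smul_div_pow (L : Submodule ℤ F) [DiscreteTopology L]
    [IsZLattice ℝ L] {s : Set F} (hb : IsBounded s) (hm : MeasurableSet s) (hc : Convex ℝ s) :
    Tendsto (fun t : ℕ => (Nat.card (s ∩ (t : ℝ)⁻¹ • (L : Set F) : Set F) : ℝ) / t ^ finrank ℝ F)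
      atTop (𝓝 (μ.real s / ZLattice.covolume L μ)) := by
  have := ZLattice.module_free ℝ L
  have := ZLattice.module_finite ℝ L
  set b := Free.chooseBasis ℤ L
  have hcount := ZLattice.covolume.tendsto_card_div_pow'' b hb hm
    (Convex.addHaar_frontier _ (hc.linear_image (b.ofZLatticeBasis ℝ L).equivFun.toLinearMap))
  rwa [← finrank_eq_card_basis (b.ofZLatticeBasis ℝ L), eq_div_of_mul_eq
    (ZLattice.covolume_pos L μ).ne'
    ((mul_comm _ _).trans (measureReal_eq_covolume_mul μ L b s).symm)] at hcount

end Covolume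

variable {E : Type*}

/-- The group `ℤ^E` of integer vectors in `ℝ^E`. -/
def integerVectors (E : Type*) : AddSubgroup (E → ℝ) :=
  AddSubgroup.pi Set.univ fun _ => (Int.castAddHom ℝ).range

/-- The integer points of a set in `ℝ^E`. -/
def integerPoints (P : Set (E → ℝ)) : Set (E → ℝ) := P ∩ integerVectors E

theorem mem_integerVectors {x : E → ℝ} : x ∈ integerVectors E ↔ ∀ e, ∃ k : ℤ, x e = k := by
  simp only [integerVectors, AddSubgroup.mem_pi, Set.mem_univ, forall_true_left,
    AddMonoidHom.mem_range, Int.coe_castAddHom, eq_comm]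

theorem mem_integerLattice {V : Submodule ℝ (E → ℝ)} {v : V} :
    v ∈ integerLattice V ↔ (v : E → ℝ) ∈ integerVectors E :=
  mem_integerVectors.symm

instance integerLattice.discreteTopology [Finite E] (V : Submodule ℝ (E → ℝ)) :
    DiscreteTopology (integerLattice V) := by
  cases nonempty_fintype E
  refine DiscreteTopology.of_forall_le_dist one_pos fun x y hxy => ?_
  obtain ⟨e, he⟩ := Function.ne_iff.1 fun h => hxy (Subtype.ext (Subtype.ext h))
  obtain ⟨k, hk⟩ := x.2 e
  obtain ⟨l, hl⟩ := y.2 e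
  have hkl : k ≠ l := fun h => he (hk.trans ((congrArg Int.cast h).trans hl.symm))
  refine le_trans ?_ (dist_le_pi_dist ((x : V) : E → ℝ) ((y : V) : E → ℝ) e)
  rw [hk, hl, Int.dist_cast_real]
  exact Int.pairwise_one_le_dist hkl

theorem isZLattice_integerLattice_vectorSpan [Fintype E] {P : Set (E → ℝ)}
    (hspan : vectorSpan ℝ P ≤ vectorSpan ℝ (integerPoints P)) :
    IsZLattice ℝ (integerLattice (vectorSpan ℝ P)) := by
  refine ⟨Submodule.map_injective_of_injective (vectorSpan ℝ P).subtype_injective ?_⟩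
  rw [Submodule.map_span, Submodule.map_subtype_top]
  refine le_antisymm (Submodule.span_le.2 ?_) (hspan.trans (Submodule.span_mono ?_))
  · rintro _ ⟨v, -, rfl⟩
    exact v.2
  · rintro _ ⟨x, hx, y, hy, rfl⟩
    exact ⟨⟨x - y, vsub_mem_vectorSpan ℝ hx.1 hy.1⟩,
      mem_integerLattice.2 (sub_mem hx.2 hy.2), rfl⟩

theorem card_integerPoints_smul {P : Set (E → ℝ)} {p : E → ℝ} (hp : p ∈ integerPoints P) {t : ℕ}
    (ht : t ≠ 0) :
    Nat.card ({v : vectorSpan ℝ P | p + (v : E → ℝ) ∈ P} ∩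
      (t : ℝ)⁻¹ • (integerLattice (vectorSpan ℝ P) : Set (vectorSpan ℝ P)) : Set (vectorSpan ℝ P))
      = Nat.card (integerPoints ((t : ℝ) • P)) := by
  have ht' : (t : ℝ) ≠ 0 := Nat.cast_ne_zero.2 ht
  have htp : (t : ℝ) • p ∈ integerVectors E := by
    rw [Nat.cast_smul_eq_nsmul]
    exact nsmul_mem hp.2 t
  have hinj : Function.Injective fun v : vectorSpan ℝ P => (t : ℝ) • (p + (v : E → ℝ)) :=
    (smul_right_injective _ ht').comp ((add_right_injective p).comp Subtype.val_injective)
  rw [← Nat.card_image_of_injective hinj]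
  congr 2
  ext x
  constructor
  · rintro ⟨v, ⟨hvP, hvL⟩, rfl⟩
    rw [Set.mem_inv_smul_set_iff₀ ht', SetLike.mem_coe, mem_integerLattice] at hvL
    refine ⟨Set.smul_mem_smul_set hvP, ?_⟩
    simpa only [smul_add, Submodule.coe_smul, SetLike.mem_coe] using add_mem htp hvL
  · rintro ⟨⟨y, hy, rfl⟩, hx⟩
    refine ⟨⟨y - p, vsub_mem_vectorSpan ℝ hy hp.1⟩, ⟨?_, ?_⟩, ?_⟩
    · simpa using hy
    · rw [Set.mem_inv_smul_set_iff₀ ht', SetLike.mem_coe, mem_integerLattice]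
      simpa only [Submodule.coe_smul, smul_sub] using sub_mem hx htp
    · simp

variable [Fintype E] {P : Set (E → ℝ)}

theorem normalizedVolume_eq_of_mem {p : E → ℝ} (hp : p ∈ P) :
    normalizedVolume P = (finrank ℝ (vectorSpan ℝ P)).factorial *
      ((Measure.addHaar : Measure (vectorSpan ℝ P)).real
        {v : vectorSpan ℝ P | p + (v : E → ℝ) ∈ P} /
          ZLattice.covolume (integerLattice (vectorSpan ℝ P)) Measure.addHaar) := by
  have hne : P.Nonempty := ⟨p, hp⟩
  have hw : hne.some - p ∈ vectorSpan ℝ P := vsub_mem_vectorSpan ℝ hne.some_mem hp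
  have htranslate : {v : vectorSpan ℝ P | hne.some + (v : E → ℝ) ∈ P}
      = (· + ⟨hne.some - p, hw⟩) ⁻¹' {v : vectorSpan ℝ P | p + (v : E → ℝ) ∈ P} := by
    ext v
    have : p + ((v : E → ℝ) + (hne.some - p)) = hne.some + v := by abel
    simp [this]
  rw [normalizedVolume, dif_pos hne]
  simp only [htranslate, Measure.real, measure_preimage_add_right]

theorem tendsto_card_integerPoints_smul_div_pow (hb : IsBounded P) (hclosed : IsClosed P)
    (hc : Convex ℝ P) (hne : (integerPoints P).Nonempty)
    (hspan : vectorSpan ℝ P ≤ vectorSpan ℝ (integerPoints P)) :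
    Tendsto (fun t : ℕ => (Nat.card (integerPoints ((t : ℝ) • P)) : ℝ) /
      t ^ finrank ℝ (vectorSpan ℝ P)) atTop
        (𝓝 (normalizedVolume P / (finrank ℝ (vectorSpan ℝ P)).factorial)) := by
  obtain ⟨p, hp⟩ := hne
  have := isZLattice_integerLattice_vectorSpan hspan
  have hcont : Continuous fun v : vectorSpan ℝ P => p + (v : E → ℝ) := by fun_prop
  have hbounded : IsBounded {v : vectorSpan ℝ P | p + (v : E → ℝ) ∈ P} := by
    rw [← isBounded_image_subtype_val]
    refine (hb.vadd (-p)).subset ?_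
    rintro _ ⟨v, hv, rfl⟩
    exact ⟨_, hv, by simp⟩
  have hconvex : Convex ℝ {v : vectorSpan ℝ P | p + (v : E → ℝ) ∈ P} :=
    (hc.translate_preimage_right p).linear_preimage (vectorSpan ℝ P).subtype
  have hlim := tendsto_card_inter_inv_smul_div_pow Measure.addHaar
    (integerLattice (vectorSpan ℝ P)) hbounded (hclosed.preimage hcont).measurableSet hconvex
  rw [normalizedVolume_eq_of_mem hp.1, mul_div_cancel_left₀ _ (by positivity)]
  refine hlim.congr' ?_
  filter_upwards [eventually_ne_atTop 0] with t ht
  rw [card_integerPoints_smul hp ht]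

end LatticePointCount

section Asymptotics

open Filter Topology Finset
open scoped Nat

theorem tendsto_choose_add_div_pow (c d : ℕ) :
    Tendsto (fun t : ℕ => ((c + t).choose d : ℝ) / t ^ d) atTop (𝓝 (d ! : ℝ)⁻¹) := by
  have hshift : Tendsto (fun t : ℕ => c + t) atTop atTop :=
    tendsto_atTop_mono (fun t => Nat.le_add_left t c) tendsto_id
  have hratio : Tendsto (fun t : ℕ => ((c : ℝ) * (t : ℝ)⁻¹ + 1) ^ d / d !) atTop
      (𝓝 (d ! : ℝ)⁻¹) := by
    have := (((tendsto_inv_atTop_nhds_zero_nat (𝕜 := ℝ)).const_mul (c : ℝ)).add_const 1).pow d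
    simpa using this.div_const (d ! : ℝ)
  have hequiv := ((isEquivalent_choose d).comp_tendsto hshift).div
    (Asymptotics.IsEquivalent.refl (u := fun t : ℕ => (t : ℝ) ^ d))
  refine hequiv.symm.tendsto_nhds (hratio.congr' ?_)
  filter_upwards [eventually_ne_atTop 0] with t ht
  have ht : (t : ℝ) ≠ 0 := Nat.cast_ne_zero.2 ht
  simp only [Function.comp_apply, Pi.div_apply, Nat.cast_add]
  rw [div_right_comm, ← div_pow, add_div, div_self ht, div_eq_mul_inv (c : ℝ)]

namespace LooplessGraph

variable {n : ℕ} {E : Type*} [Fintype E] (H : LooplessGraph n E)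

theorem tendsto_kostant_smul_unitNetflow (hin : ∀ j, 1 ≤ j → j ≤ n → (H.inEdges j).Nonempty)
    (hout : ∀ j < n, (H.outEdges j).Nonempty) (hn : 1 ≤ n) :
    Tendsto (fun t : ℕ => (H.kostant (t • unitNetflow n) : ℝ) / t ^ (Fintype.card E - n)) atTop
      (𝓝 (H.kostant H.indegVector / (Fintype.card E - n)!)) := by
  classical
  set d := Fintype.card E - n
  have hbelow : H.kostant H.indegVector = #(H.kostantBelow n) := by
    rw [kostant, ← H.coe_kostantBelow_last hin hn, Set.ncard_coe_finset]
  have hflows (t : ℕ) : H.kostant (t • unitNetflow n) = #(H.flowsFrom t 1) := by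
    rw [kostant, ← H.coe_flowsFrom_one, Set.ncard_coe_finset]
  simp only [div_eq_mul_inv (H.kostant H.indegVector : ℝ)]
  refine tendsto_of_tendsto_of_tendsto_of_le_of_le
    ((tendsto_choose_add_div_pow 0 d).const_mul (H.kostant H.indegVector : ℝ))
    ((tendsto_choose_add_div_pow d d).const_mul (H.kostant H.indegVector : ℝ))
    (fun t => ?_) (fun t => ?_)
  · simp only [zero_add, ← mul_div_assoc]
    gcongr
    rw [hflows, hbelow]
    exact_mod_cast H.le_card_flowsFrom hin hn t
  · simp only [← mul_div_assoc]
    gcongr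
    rw [hflows, hbelow]
    exact_mod_cast H.card_flowsFrom_le hin hout hn t

end LooplessGraph

end Asymptotics

section FlowPolytope

open Bornology Module Finset Pointwise

namespace LooplessGraph

variable {n : ℕ} {E : Type*} [Fintype E] (H : LooplessGraph n E)

theorem convex_flowPolytope (a : Fin (n + 1) → ℤ) : Convex ℝ (H.flowPolytope a) := by
  intro f hf g hg s t hs ht hst
  rw [mem_flowPolytope] at hf hg ⊢
  refine ⟨add_nonneg (smul_nonneg hs hf.1) (smul_nonneg ht hg.1), ?_⟩
  rw [map_add, map_smul, map_smul, hf.2, hg.2, ← add_smul, hst, one_smul]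

theorem isClosed_flowPolytope (a : Fin (n + 1) → ℤ) : IsClosed (H.flowPolytope a) := by
  simp only [flowPolytope, Set.ofPred_and, Set.ofPred_forall]
  exact (isClosed_iInter fun e => isClosed_le continuous_const (continuous_apply e)).inter
    (isClosed_iInter fun v => isClosed_eq (by fun_prop) continuous_const)

theorem isBounded_flowPolytope (a : Fin (n + 1) → ℤ) : IsBounded (H.flowPolytope a) := by
  -- Every edge climbs by at least one, so the total climb of a flow dominates each of its values.
  set c : ℝ := ∑ v, (a v : ℝ) * -(v : ℝ)
  refine (Metric.isBounded_Icc (0 : E → ℝ) fun _ => c).subset fun f hf => ?_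
  obtain ⟨hnonneg, hnetflow⟩ := H.mem_flowPolytope.1 hf
  have hclimb (e : E) : (1 : ℝ) ≤ (H.fin e : ℕ) - (H.init e : ℕ) := by
    rw [le_sub_iff_add_le']
    exact_mod_cast H.init_lt_fin_val e
  have hc : c = ∑ e, f e * ((H.fin e : ℕ) - (H.init e : ℕ)) := by
    have := H.sum_netflow_smul f fun v => -(v : ℝ)
    simpa only [hnetflow, smul_eq_mul, neg_sub_neg] using this
  refine ⟨hnonneg, fun e => ?_⟩
  calc f e ≤ f e * ((H.fin e : ℕ) - (H.init e : ℕ)) :=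
        le_mul_of_one_le_right (hnonneg e) (hclimb e)
    _ ≤ ∑ e, f e * ((H.fin e : ℕ) - (H.init e : ℕ)) :=
        single_le_sum (f := fun e => f e * ((H.fin e : ℕ) - (H.init e : ℕ) : ℝ))
          (fun e _ => mul_nonneg (hnonneg e) (zero_le_one.trans (hclimb e))) (mem_univ e)
    _ = c := hc.symm

theorem smul_flowPolytope (a : Fin (n + 1) → ℤ) {t : ℕ} (ht : t ≠ 0) :
    (t : ℝ) • H.flowPolytope a = H.flowPolytope (t • a) := by
  have ht' : (0 : ℝ) < t := by positivity
  ext f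
  rw [Set.mem_smul_set_iff_inv_smul_mem₀ ht'.ne', mem_flowPolytope, mem_flowPolytope, map_smul,
    inv_smul_eq_iff₀ ht'.ne', smul_nonneg_iff_nonneg_of_pos_left (inv_pos.2 ht')]
  simp [funext_iff]

theorem integerPoints_flowPolytope (a : Fin (n + 1) → ℤ) :
    integerPoints (H.flowPolytope a) = (fun b e => (b e : ℝ)) '' H.kostantSet a := by
  ext f
  constructor
  · rintro ⟨hf, hint⟩
    obtain ⟨hnonneg, hnetflow⟩ := H.mem_flowPolytope.1 hf
    choose k hk using mem_integerVectors.1 hint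
    have hk' (e : E) : 0 ≤ k e := Int.cast_nonneg_iff.1 ((hnonneg e).trans_eq (hk e))
    lift k to E → ℕ using hk'
    obtain rfl : (fun e => (k e : ℝ)) = f := funext fun e => by simp [hk]
    exact ⟨k, (H.mem_kostantSet_iff_netflow ℝ).2 hnetflow, rfl⟩
  · rintro ⟨b, hb, rfl⟩
    exact ⟨H.mem_flowPolytope.2 ⟨fun e => Nat.cast_nonneg _,
      (H.mem_kostantSet_iff_netflow ℝ).1 hb⟩, mem_integerVectors.2 fun e => ⟨b e, by simp⟩⟩

theorem card_integerPoints_flowPolytope (a : Fin (n + 1) → ℤ) :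
    Nat.card (integerPoints (H.flowPolytope a)) = H.kostant a := by
  rw [integerPoints_flowPolytope, Nat.card_image_of_injective]
  · rfl
  · exact Nat.cast_injective.comp_left

theorem vectorSpan_flowPolytope_le (a : Fin (n + 1) → ℤ) :
    vectorSpan ℝ (H.flowPolytope a) ≤ LinearMap.ker (H.netflow ℝ) := by
  refine Submodule.span_le.2 ?_
  rintro _ ⟨f, hf, g, hg, rfl⟩
  change H.netflow ℝ (f - g) = 0
  rw [map_sub, (H.mem_flowPolytope.1 hf).2,
    (H.mem_flowPolytope.1 hg).2, sub_self]

theorem ker_netflow_le_span [DecidableEq E] (q : Fin (n + 1) → E → ℝ) :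
    LinearMap.ker (H.netflow ℝ)
      ≤ Submodule.span ℝ (Set.range fun e => Pi.single e 1 - (q (H.init e) - q (H.fin e))) := by
  intro f hf
  have hq : ∑ e, f e • (q (H.init e) - q (H.fin e)) = 0 := by
    rw [← H.sum_netflow_smul, LinearMap.mem_ker.1 hf]
    simp
  have hf : f = ∑ e, f e • (Pi.single e 1 - (q (H.init e) - q (H.fin e))) := by
    simp only [smul_sub (f _) (Pi.single _ _), sum_sub_distrib, hq, sub_zero]
    exact pi_eq_sum_univ' f
  rw [hf]
  exact sum_mem fun e _ => Submodule.smul_mem _ _ (Submodule.subset_span ⟨e, rfl⟩)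

theorem ker_netflow_le_vectorSpan (hin : ∀ j, 1 ≤ j → j ≤ n → (H.inEdges j).Nonempty)
    (hout : ∀ j < n, (H.outEdges j).Nonempty) :
    LinearMap.ker (H.netflow ℝ)
      ≤ vectorSpan ℝ (integerPoints (H.flowPolytope (unitNetflow n))) := by
  classical
  choose p hp using H.exists_flow_from_zero hin
  choose q hq using H.exists_flow_to_last hout
  -- The generator of `e` is the difference of two paths through `init e`: one continues along `e`
  -- and `q (fin e)`, the other along `q (init e)`.
  have hpath (v : Fin (n + 1)) : p v + q v ∈ H.kostantSet (unitNetflow n) := by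
    simpa [unitNetflow] using H.add_mem_kostantSet (hp v) (hq v)
  have hreroute (e : E) :
      p (H.init e) + Pi.single e 1 + q (H.fin e) ∈ H.kostantSet (unitNetflow n) := by
    simpa [unitNetflow, root] using H.add_mem_kostantSet
      (H.add_mem_kostantSet (hp (H.init e)) (H.single_mem_kostantSet e)) (hq (H.fin e))
  refine (H.ker_netflow_le_span fun v e => (q v e : ℝ)).trans (Submodule.span_le.2 ?_)
  rintro _ ⟨e, rfl⟩
  rw [integerPoints_flowPolytope]
  refine Set.mem_of_eq_of_mem (funext fun e' => ?_)
    (vsub_mem_vectorSpan ℝ (Set.mem_image_of_mem _ (hreroute e))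
      (Set.mem_image_of_mem _ (hpath (H.init e))))
  simp only [Pi.single_apply, Pi.sub_apply, Pi.add_apply, Pi.vsub_apply, vsub_eq_sub, Nat.cast_add,
    Nat.cast_ite, Nat.cast_one, Nat.cast_zero]
  ring

theorem mem_range_netflow (hout : ∀ j < n, (H.outEdges j).Nonempty) {g : Fin (n + 1) → ℝ} :
    g ∈ LinearMap.range (H.netflow ℝ) ↔ ∑ v, g v = 0 := by
  classical
  constructor
  · rintro ⟨f, rfl⟩
    exact H.sum_netflow f
  · intro hg
    choose q hq using H.exists_flow_to_last hout
    refine ⟨∑ v, g v • fun e => (q v e : ℝ), ?_⟩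
    ext w
    simp only [map_sum, map_smul, fun v => (H.mem_kostantSet_iff_netflow ℝ).1 (hq v)]
    simp [Pi.single_apply, mul_sub, hg]

theorem finrank_ker_netflow (hout : ∀ j < n, (H.outEdges j).Nonempty) :
    finrank ℝ (LinearMap.ker (H.netflow ℝ)) = Fintype.card E - n := by
  set σ : Dual ℝ (Fin (n + 1) → ℝ) := Fintype.linearCombination ℝ fun _ => 1
  have hrange : LinearMap.range (H.netflow ℝ) = LinearMap.ker σ := by
    ext g
    rw [H.mem_range_netflow hout, LinearMap.mem_ker]
    simp [σ, Fintype.linearCombination_apply]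
  have hσ_ne : σ ≠ 0 := fun h => by
    simpa [σ] using LinearMap.congr_fun h (Pi.single 0 1)
  have hdual := Dual.finrank_ker_add_one_of_ne_zero hσ_ne
  have hrank := (H.netflow ℝ).finrank_range_add_finrank_ker
  rw [hrange, finrank_fintype_fun_eq_card] at hrank
  rw [finrank_fintype_fun_eq_card, Fintype.card_fin] at hdual
  omega

end LooplessGraph

end FlowPolytope

theorem theorem6p1 {n : ℕ} (hn : 1 ≤ n) {E : Type*} [Fintype E] (H : LooplessGraph n E)
    (hconn : H.Connected)
    (hin : ∀ i : Fin (n + 1), 0 < i → i < Fin.last n → 1 ≤ H.indeg i)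
    (hout : ∀ i : Fin (n + 1), 0 < i → i < Fin.last n → 1 ≤ H.outdeg i) :
    normalizedVolume (H.flowPolytope (unitNetflow n)) = (H.kostant H.indegVector : ℝ) := by
  have hin' := H.inEdges_nonempty hconn hin
  have hout' := H.outEdges_nonempty hconn hout
  set P := H.flowPolytope (unitNetflow n)
  have hspan := H.ker_netflow_le_vectorSpan hin' hout'
  have hdir := H.vectorSpan_flowPolytope_le (unitNetflow n)
  have hdim : Module.finrank ℝ (vectorSpan ℝ P) = Fintype.card E - n := by
    rw [hdir.antisymm (hspan.trans (vectorSpan_mono ℝ Set.inter_subset_left)),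
      H.finrank_ker_netflow hout']
  have hne : (integerPoints P).Nonempty := by
    rw [H.integerPoints_flowPolytope]
    exact (H.exists_flow_to_last hout' 0).image _
  have hvol := tendsto_card_integerPoints_smul_div_pow (H.isBounded_flowPolytope _)
    (H.isClosed_flowPolytope _) (H.convex_flowPolytope _) hne (hdir.trans hspan)
  rw [hdim] at hvol
  have hkostant := H.tendsto_kostant_smul_unitNetflow hin' hout' hn
  refine (div_left_inj' (by positivity)).1 (tendsto_nhds_unique_of_eventuallyEq hvol hkostant ?_)
  filter_upwards [Filter.eventually_ne_atTop 0] with t ht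
  rw [H.smul_flowPolytope _ ht, H.card_integerPoints_flowPolytope]
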